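/- Let $D=\{z\in\mathbb C:|z|<1\}$. For $f:\mathbb R\to\mathbb R$ let $\|f\|=\sup_I\left|\int_I f\right|$ be the Alexiewicz norm, where $I$ ranges over the intervals $I\subset\mathbb R$ of length at most $2\pi$, the integrals are Henstock--Kurzweil integrals, and $\|f\|=\infty$ if $f$ is not Henstock--Kurzweil integrable over some such $I$. Let $\mathcal{HK}$ be the set of $2\pi$-periodic functions $f:\mathbb R\to\mathbb R$ with $\|f\|<\infty$. For $0\le r<1$ let $\Phi_r(\theta)=\dfrac{1-r^2}{2\pi(1-2r\cos\theta+r^2)}$ be the Poisson kernel, and for a function $u:D\to\mathbb R$ write $u_r(\theta)=u(re^{i\theta})$. Theorem. Let $f\in\mathcal{HK}$. Then for all $0\le r<1$ and $\theta\in\mathbb R$ the Poisson integral $$P[f](re^{i\theta})=\int_{-\pi}^{\pi}f(\phi)\,\Phi_r(\phi-\theta)\,d\phi$$ exists as a Henstock--Kurzweil integral (and depends only on the point $re^{i\theta}$), and the Dirichlet problem $$u\in C^2(D),\qquad \Delta u=0\ \text{ in } D,\qquad \|u_r-f\|\to 0\ \text{ as } r\to 1^-$$ has the unique solution $u=P[f]$;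 that is, $P[f]$ is a solution, and every $u:D\to\mathbb R$ which is a solution equals $P[f]$ on $D$. -/

import Mathlib

open scoped Topology ENNReal Laplacian

noncomputable section

namespace HKPoisson

/-- The segment from `a` to `b` (with `a < b`) as a one-dimensional box. -/
def segmentBox (a b : ℝ) (h : a < b) : BoxIntegral.Box (Fin 1) where
  lower := fun _ => a
  upper := fun _ => b
  lower_lt_upper := fun _ => h

/-- `f` is Henstock–Kurzweil integrable on `[a, b]`, `a < b`, with integral `y`. -/
def HasHKIntegral (f : ℝ → ℝ) (a b y : ℝ) : Prop :=
  ∃ h : a < b, BoxIntegral.HasIntegral (segmentBox a b h) BoxIntegral.IntegrationParams.Henstock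
    (fun x => f (x 0)) BoxIntegral.BoxAdditiveMap.volume y

/-- `f` is Henstock–Kurzweil integrable on `[a, b]`, `a < b`. -/
def HKIntegrable (f : ℝ → ℝ) (a b : ℝ) : Prop :=
  ∃ y, HasHKIntegral f a b y

/-- The Henstock–Kurzweil integral of `f` over `[a, b]`
(it is `0` by convention if `f` is not integrable or `b ≤ a`). -/
def hkIntegral (f : ℝ → ℝ) (a b : ℝ) : ℝ :=
  if h : a < b then
    BoxIntegral.integral (segmentBox a b h) BoxIntegral.IntegrationParams.Henstock
      (fun x => f (x 0)) BoxIntegral.BoxAdditiveMap.volume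
  else 0

open Classical in
/-- The Alexiewicz norm of `f`: the supremum of `|∫_I f|` over the intervals `I ⊆ ℝ` of length at
most `2π`. It takes values in `[0, ∞]`, and it is `∞` as soon as `f` fails to be
Henstock–Kurzweil integrable on one of these intervals. (The endpoints of `I` do not affect the
integral and degenerate intervals contribute `0`, so `I` ranges over `[a, b]` with `a < b`.) -/
def alexiewiczNorm (f : ℝ → ℝ) : ℝ≥0∞ :=
  ⨆ (a : ℝ) (b : ℝ) (_ : a < b) (_ : b - a ≤ 2 * Real.pi),
    if HKIntegrable f a b then ENNReal.ofReal |hkIntegral f a b| else ⊤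

/-- The space of `2π`-periodic functions with finite Alexiewicz norm. -/
def HK : Set (ℝ → ℝ) :=
  {f | Function.Periodic f (2 * Real.pi) ∧ alexiewiczNorm f < ⊤}

/-- The Poisson kernel `Φ_r(θ)` of the unit disc. -/
def poissonKernel (r θ : ℝ) : ℝ :=
  (1 - r ^ 2) / (2 * Real.pi * (1 - 2 * r * Real.cos θ + r ^ 2))

/-- The point `r e^{iθ}`. -/
def polar (r θ : ℝ) : ℂ :=
  (r : ℂ) * Complex.exp ((θ : ℂ) * Complex.I)

/-- The Poisson integral `P[f]`, as a function of `z = r e^{iθ}` with `r = |z|`, `θ = arg z`. -/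
def poissonIntegral (f : ℝ → ℝ) (z : ℂ) : ℝ :=
  hkIntegral (fun φ => f φ * poissonKernel ‖z‖ (φ - z.arg)) (-Real.pi) Real.pi

/-- `u` solves the Dirichlet problem in the open unit disc `D` with boundary data `f`, assumed in
the Alexiewicz norm. Only the values of `u` in `D` matter. -/
structure IsDirichletSolution (f : ℝ → ℝ) (u : ℂ → ℝ) : Prop where
  contDiffOn : ContDiffOn ℝ 2 u (Metric.ball 0 1)
  laplacian_eq_zero : ∀ z ∈ Metric.ball (0 : ℂ) 1, Δ u z = 0
  tendsto_boundary :
    Filter.Tendsto (fun r : ℝ => alexiewiczNorm (fun θ => u (polar r θ) - f θ)) (𝓝[<] 1) (𝓝 0)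

end HKPoisson

end

/-!
Let `m` be the mean of `f` over a period. The indefinite integral `G` of `f - m` is continuous and
`2π`-periodic, so integration by parts turns `P[f]` into `m` plus the angular derivative of the
classical Poisson integral of `G`. The latter is `Re h` for the Herglotz integral `h` of `G`, hence
`P[f] z = m + Re (i z h' z)` is harmonic. Moreover `∫ₐᵇ (P[f]_r - f)` is the increment over `[a, b]`
of `(Re h)_r - G`, which tends to `0` uniformly as `r → 1`.

For uniqueness, a harmonic `u` satisfies `u (R z) = ∫ u_R K_z` with the Poisson kernel `K_z` at `z`.
Integrating by parts, `|u (R z) - P[f] z| = |∫ (u_R - f) K_z| ≤ C_z ‖u_R - f‖`, and `R → 1` gives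
`u z = P[f] z`.
-/

namespace HKPoisson

open BoxIntegral MeasureTheory Filter Set
open scoped Real

section Segment

theorem segmentBox_lower_upper (J : Box (Fin 1)) :
    segmentBox (J.lower 0) (J.upper 0) (J.lower_lt_upper 0) = J := by
  ext x
  simp [Box.mem_def, segmentBox]

theorem segmentBox_le_segmentBox {a b u v : ℝ} (hab : a < b) (huv : u < v) (hau : a ≤ u)
    (hvb : v ≤ b) : segmentBox u v huv ≤ segmentBox a b hab :=
  Box.le_iff_bounds.2 ⟨fun _ => hau, fun _ => hvb⟩

theorem volume_apply_fin_one (J : Box (Fin 1)) (y : ℝ) :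
    BoxAdditiveMap.volume J y = (J.upper 0 - J.lower 0) * y := by
  rw [BoxAdditiveMap.volume_apply, Fin.prod_univ_one, smul_eq_mul]

/-- The increment of a function of one variable over a segment, as a box-additive map. -/
def increment (G : ℝ → ℝ) : Fin 1 →ᵇᵃ ℝ :=
  BoxAdditiveMap.ofMapSplitAdd (fun J => G (J.upper 0) - G (J.lower 0)) ⊤ (by
    intro J _ i x hx
    obtain rfl : i = 0 := Subsingleton.elim _ _
    rw [Box.splitLower_def hx, Box.splitUpper_def hx]
    change (G (Function.update J.upper 0 x 0) - G (J.lower 0)) +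
      (G (J.upper 0) - G (Function.update J.lower 0 x 0)) = _
    rw [Function.update_self, Function.update_self]
    ring)

theorem sum_increment {I : Box (Fin 1)} (G : ℝ → ℝ) {P : TaggedPrepartition I}
    (hP : P.IsPartition) :
    ∑ J ∈ P.boxes, (G (J.upper 0) - G (J.lower 0)) = G (I.upper 0) - G (I.lower 0) :=
  (increment G).sum_partition_boxes le_top hP

theorem abs_sub_tag_le_of_isSubordinate {I J : Box (Fin 1)} {P : TaggedPrepartition I}
    {r : (Fin 1 → ℝ) → Ioi (0 : ℝ)} (hP : P.IsSubordinate r) (hJ : J ∈ P) :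
    |J.lower 0 - P.tag J 0| ≤ r (P.tag J) ∧ |J.upper 0 - P.tag J 0| ≤ r (P.tag J) :=
  have hball := hP J hJ
  ⟨(dist_le_pi_dist _ _ 0).trans (hball J.lower_mem_Icc),
    (dist_le_pi_dist _ _ 0).trans (hball J.upper_mem_Icc)⟩

end Segment

section HasHKIntegral

variable {f g : ℝ → ℝ} {a b c y z : ℝ}

theorem HasHKIntegral.lt (h : HasHKIntegral f a b y) : a < b := h.1

theorem HasHKIntegral.unique (h : HasHKIntegral f a b y) (h' : HasHKIntegral f a b z) : y = z :=
  h.2.unique h'.2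

theorem HasHKIntegral.hkIntegral_eq (h : HasHKIntegral f a b y) : hkIntegral f a b = y := by
  rw [hkIntegral, dif_pos h.1]
  exact h.2.integral_eq

theorem HKIntegrable.hasHKIntegral (h : HKIntegrable f a b) :
    HasHKIntegral f a b (hkIntegral f a b) := by
  obtain ⟨y, hy⟩ := h
  rwa [hy.hkIntegral_eq]

@[simp] theorem hkIntegral_self (f : ℝ → ℝ) (a : ℝ) : hkIntegral f a a = 0 := by
  simp [hkIntegral]

theorem hasHKIntegral_zero (hab : a < b) : HasHKIntegral (fun _ => 0) a b 0 :=
  ⟨hab, hasIntegral_zero⟩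

theorem HasHKIntegral.add (h : HasHKIntegral f a b y) (h' : HasHKIntegral g a b z) :
    HasHKIntegral (fun x => f x + g x) a b (y + z) :=
  ⟨h.1, h.2.add h'.2⟩

theorem HasHKIntegral.sub (h : HasHKIntegral f a b y) (h' : HasHKIntegral g a b z) :
    HasHKIntegral (fun x => f x - g x) a b (y - z) :=
  ⟨h.1, h.2.sub h'.2⟩

theorem HKIntegrable.mono {u v : ℝ} (h : HKIntegrable f a b) (hau : a ≤ u) (huv : u < v)
    (hvb : v ≤ b) : HKIntegrable f u v := by
  obtain ⟨y, hab, hy⟩ := h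
  obtain ⟨z, hz⟩ := hy.integrable.to_subbox (segmentBox_le_segmentBox hab huv hau hvb)
  exact ⟨z, huv, hz⟩

theorem hkIntegral_add_adjacent (h : HKIntegrable f a b) (hac : a < c) (hcb : c < b) :
    hkIntegral f a c + hkIntegral f c b = hkIntegral f a b := by
  obtain ⟨y, hab, hy⟩ := h
  have hc : c ∈ Ioo ((segmentBox a b hab).lower 0) ((segmentBox a b hab).upper 0) := ⟨hac, hcb⟩
  have hsplit := hy.integrable.toBoxAdditive.map_split_add le_rfl (0 : Fin 1) c
  rw [Box.splitLower_def hc, Box.splitUpper_def hc] at hsplit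
  rw [hkIntegral, hkIntegral, hkIntegral, dif_pos hac, dif_pos hcb, dif_pos hab]
  refine Eq.trans ?_ hsplit
  congr 1 <;>
  · simp only [Integrable.toBoxAdditive, BoxAdditiveMap.coe_mk, Option.elim']
    congr 1
    rw [← segmentBox_lower_upper ⟨_, _, _⟩]
    simp [segmentBox]

theorem HKIntegrable.hasHKIntegral_add_adjacent (h : HKIntegrable f a b)
    (hac : HasHKIntegral f a c y) (hcb : HasHKIntegral f c b z) : HasHKIntegral f a b (y + z) := by
  rw [← hac.hkIntegral_eq, ← hcb.hkIntegral_eq, hkIntegral_add_adjacent h hac.lt hcb.lt]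
  exact h.hasHKIntegral

end HasHKIntegral

section SaksHenstock

/-- `F` is an indefinite Henstock–Kurzweil integral of `f` on `[a, b]`. -/
def IsHKPrimitive (f F : ℝ → ℝ) (a b : ℝ) : Prop :=
  ∀ u v, a ≤ u → u < v → v ≤ b → HasHKIntegral f u v (F v - F u)

/-- The Saks–Henstock sum of a tagged prepartition: the total error made when the increments of `F`
over its segments are replaced by the terms of the Riemann sum of `f`. -/
def saksHenstockSum (f F : ℝ → ℝ) {I : Box (Fin 1)} (P : TaggedPrepartition I) : ℝ :=
  ∑ J ∈ P.boxes, |(J.upper 0 - J.lower 0) * f (P.tag J 0) - (F (J.upper 0) - F (J.lower 0))|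

variable {f F : ℝ → ℝ} {a b : ℝ}

theorem isHKPrimitive_zero (a b : ℝ) : IsHKPrimitive (fun _ => 0) (fun _ => 0) a b :=
  fun _ _ _ huv _ => by simpa only [sub_zero] using hasHKIntegral_zero huv

theorem HKIntegrable.isHKPrimitive (h : HKIntegrable f a b) :
    IsHKPrimitive f (fun x => hkIntegral f a x) a b := by
  intro u v hau huv hvb
  have huvint := (h.mono hau huv hvb).hasHKIntegral
  rcases hau.eq_or_lt with rfl | hau
  · simpa using huvint
  · simpa [← hkIntegral_add_adjacent (h.mono le_rfl (hau.trans huv) hvb) hau huv] using huvint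

theorem sum_abs_le_two_mul {ι : Type*} {s : Finset ι} {t : ι → ℝ} {ε : ℝ}
    (h : ∀ u ⊆ s, |∑ i ∈ u, t i| ≤ ε) : ∑ i ∈ s, |t i| ≤ 2 * ε := by
  have hpos : ∑ i ∈ s with 0 ≤ t i, |t i| ≤ ε := by
    rw [Finset.sum_congr rfl fun i hi => abs_of_nonneg (Finset.mem_filter.1 hi).2]
    exact (le_abs_self _).trans (h _ (Finset.filter_subset _ _))
  have hneg : ∑ i ∈ s with ¬ 0 ≤ t i, |t i| ≤ ε := by
    rw [Finset.sum_congr rfl fun i hi => abs_of_neg (not_le.1 (Finset.mem_filter.1 hi).2),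
      Finset.sum_neg_distrib]
    exact (neg_le_abs _).trans (h _ (Finset.filter_subset _ _))
  rw [← Finset.sum_filter_add_sum_filter_not s (fun i => 0 ≤ t i)]
  linarith

theorem sum_abs_sub_integral_le_of_memBaseSet {ι E : Type*} [Fintype ι] [NormedAddCommGroup E]
    [NormedSpace ℝ E] {I : Box ι} {l : IntegrationParams} {f : (ι → ℝ) → E}
    {vol : ι →ᵇᵃ (E →L[ℝ] ℝ)} (hf : Integrable I l f vol) {ε : ℝ} (hε : 0 < ε) {c : NNReal}
    {P : TaggedPrepartition I} (hP : l.MemBaseSet I c (hf.convergenceR ε c) P) :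
    ∑ J ∈ P.boxes, |vol J (f (P.tag J)) - integral J l f vol| ≤ 2 * ε := by
  classical
  refine sum_abs_le_two_mul fun s hs => ?_
  have hboxes : (P.filter (· ∈ s)).boxes = s := by
    ext J
    exact P.mem_filter.trans ⟨And.right, fun hJ => ⟨hs hJ, hJ⟩⟩
  have hdist := hf.dist_integralSum_sum_integral_le_of_memBaseSet hε (hP.filter (· ∈ s))
  rw [Real.dist_eq, integralSum, ← Finset.sum_sub_distrib, hboxes] at hdist
  exact hdist

theorem memBaseSet_henstock {ι : Type*} [Fintype ι] {I : Box ι} {c : NNReal}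
    {r : (ι → ℝ) → Ioi (0 : ℝ)} {P : TaggedPrepartition I} (hH : P.IsHenstock)
    (hS : P.IsSubordinate r) : IntegrationParams.Henstock.MemBaseSet I c r P :=
  ⟨hS, fun _ => hH, fun h => absurd h Bool.false_ne_true, fun h => absurd h Bool.false_ne_true⟩

theorem IsHKPrimitive.exists_gauge (h : IsHKPrimitive f F a b) (hab : a < b) {ε : ℝ} (hε : 0 < ε) :
    ∃ r : (Fin 1 → ℝ) → Ioi (0 : ℝ), ∀ P : TaggedPrepartition (segmentBox a b hab),
      P.IsHenstock → P.IsSubordinate r → saksHenstockSum f F P ≤ ε := by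
  obtain ⟨_, hasInt⟩ := h a b le_rfl hab le_rfl
  refine ⟨hasInt.integrable.convergenceR (ε / 2) 0, fun P hH hS => ?_⟩
  refine le_of_eq_of_le (Finset.sum_congr rfl fun J hJ => ?_)
    ((sum_abs_sub_integral_le_of_memBaseSet hasInt.integrable (half_pos hε)
      (memBaseSet_henstock hH hS)).trans_eq (mul_div_cancel₀ ε two_ne_zero))
  have hle := Box.le_iff_bounds.1 (P.le_of_mem hJ)
  have hint := (h _ _ (hle.1 0) (J.lower_lt_upper 0) (hle.2 0)).2.integral_eq
  rw [segmentBox_lower_upper] at hint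
  rw [volume_apply_fin_one, hint]

theorem hasHKIntegral_of_forall_exists_gauge {φ G : ℝ → ℝ} (hab : a < b) (C : ℝ)
    (H : ∀ ε > 0, ∃ r : (Fin 1 → ℝ) → Ioi (0 : ℝ), ∀ P : TaggedPrepartition (segmentBox a b hab),
      P.IsHenstock → P.IsSubordinate r → P.IsPartition → saksHenstockSum φ G P ≤ C * ε) :
    HasHKIntegral φ a b (G b - G a) := by
  refine ⟨hab, HasIntegral.of_mul C fun ε hε => ?_⟩
  obtain ⟨r, hr⟩ := H ε hε
  refine ⟨fun _ => r, fun _ => IntegrationParams.rCond_of_bRiemann_eq_false _ rfl,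
    fun c P hP hpart => ?_⟩
  have hincr : ∑ J ∈ P.boxes, (G (J.upper 0) - G (J.lower 0)) = G b - G a := sum_increment G hpart
  rw [← hincr, Real.dist_eq, integralSum, ← Finset.sum_sub_distrib]
  simp only [volume_apply_fin_one]
  exact (Finset.abs_sum_le_sum_abs _ _).trans (hr P (hP.2 rfl) hP.1 hpart)

theorem IsHKPrimitive.exists_forall_abs_sub_le (h : IsHKPrimitive f F a b) (hab : a < b) {ε : ℝ}
    (hε : 0 < ε) (ξ : ℝ) :
    ∃ δ > 0, ∀ u v, a ≤ u → u < v → v ≤ b → u ≤ ξ → ξ ≤ v → ξ - u ≤ δ → v - ξ ≤ δ →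
      |(v - u) * f ξ - (F v - F u)| ≤ ε := by
  obtain ⟨r, hr⟩ := h.exists_gauge hab hε
  refine ⟨r (fun _ => ξ), (r _).2, fun u v hau huv hvb huξ hξv hu hv => ?_⟩
  have hle := segmentBox_le_segmentBox hab huv hau hvb
  have hξ : (fun _ => ξ) ∈ Box.Icc (segmentBox a b hab) :=
    ⟨fun _ => hau.trans huξ, fun _ => hξv.trans hvb⟩
  have hsub : Box.Icc (segmentBox u v huv) ⊆ Metric.closedBall (fun _ => ξ) (r fun _ => ξ) :=
    fun x hx => (dist_pi_le_iff (r _).2.le).2 fun i => by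
      have hxu : u ≤ x i := hx.1 i
      have hxv : x i ≤ v := hx.2 i
      exact abs_le.2 ⟨by linarith, by linarith⟩
  simpa [saksHenstockSum, TaggedPrepartition.single, Prepartition.single, segmentBox] using
    hr (TaggedPrepartition.single _ (segmentBox u v huv) hle (fun _ => ξ) hξ)
      ((TaggedPrepartition.isHenstock_single_iff hle hξ).2 ⟨fun _ => huξ, fun _ => hξv⟩)
      ((TaggedPrepartition.isSubordinate_single hle hξ).2 hsub)

theorem IsHKPrimitive.continuousOn (h : IsHKPrimitive f F a b) (hab : a < b) :
    ContinuousOn F (Icc a b) := by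
  intro ξ hξ
  rw [Metric.continuousWithinAt_iff']
  intro ε hε
  obtain ⟨δ, hδ, H⟩ := h.exists_forall_abs_sub_le hab (half_pos hε) ξ
  have hsmall : ∀ᶠ x in 𝓝 ξ, |(x - ξ) * f ξ| < ε / 2 :=
    ContinuousAt.eventually_lt (by fun_prop) continuousAt_const (by simp [hε])
  filter_upwards [nhdsWithin_le_nhds hsmall,
    nhdsWithin_le_nhds (Metric.closedBall_mem_nhds ξ hδ), self_mem_nhdsWithin] with x hxf hxδ hx
  rw [Metric.mem_closedBall, Real.dist_eq, abs_le] at hxδ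
  rw [abs_lt] at hxf
  rw [Real.dist_eq, abs_lt]
  rcases lt_trichotomy x ξ with hlt | rfl | hlt
  · have hinc := abs_le.1 (H x ξ hx.1 hlt hξ.2 hlt.le le_rfl (by linarith) (by linarith))
    constructor <;> linarith
  · simp [hε]
  · have hinc := abs_le.1 (H ξ x hξ.1 hlt hx.2 le_rfl hlt.le (by linarith) (by linarith))
    constructor <;> linarith

theorem exists_forall_abs_sub_le_of_hasDerivWithinAt {k : ℝ → ℝ} {k' ξ : ℝ} {s : Set ℝ}
    (h : HasDerivWithinAt k k' s ξ) {ε : ℝ} (hε : 0 < ε) :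
    ∃ δ > 0, ∀ u ∈ s, ∀ v ∈ s, u ≤ ξ → ξ ≤ v → |u - ξ| ≤ δ → |v - ξ| ≤ δ →
      |(v - u) * k' - (k v - k u)| ≤ ε * (v - u) := by
  have hbound := (hasDerivWithinAt_iff_isLittleO.1 h).def hε
  obtain ⟨δ, hδ, H⟩ := (nhdsWithin_hasBasis Metric.nhds_basis_closedBall s).eventually_iff.1 hbound
  refine ⟨δ, hδ, fun u hu v hv huξ hξv huδ hvδ => ?_⟩
  have hleft : |k u - k ξ - (u - ξ) * k'| ≤ ε * |u - ξ| := H ⟨huδ, hu⟩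
  have hright : |k v - k ξ - (v - ξ) * k'| ≤ ε * |v - ξ| := H ⟨hvδ, hv⟩
  rw [abs_of_nonpos (by linarith : u - ξ ≤ 0), abs_le] at hleft
  rw [abs_of_nonneg (by linarith : 0 ≤ v - ξ), abs_le] at hright
  exact abs_le.2 ⟨by linarith, by linarith⟩

theorem exists_forall_abs_sub_le_of_hasDerivWithinAt_sub {G : ℝ → ℝ} {c p q ξ : ℝ} {s : Set ℝ}
    (h : HasDerivWithinAt (fun x => G x - c * F x) (p - c * q) s ξ) {ε : ℝ} (hε : 0 < ε) :
    ∃ δ > 0, ∀ u ∈ s, ∀ v ∈ s, u ≤ ξ → ξ ≤ v → |u - ξ| ≤ δ → |v - ξ| ≤ δ →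
      |(v - u) * p - (G v - G u)| ≤ |c| * |(v - u) * q - (F v - F u)| + ε * (v - u) := by
  obtain ⟨δ, hδ, H⟩ := exists_forall_abs_sub_le_of_hasDerivWithinAt h hε
  refine ⟨δ, hδ, fun u hu v hv huξ hξv huδ hvδ => ?_⟩
  calc |(v - u) * p - (G v - G u)|
      = |c * ((v - u) * q - (F v - F u)) + ((v - u) * (p - c * q) -
          (G v - c * F v - (G u - c * F u)))| := by ring_nf
    _ ≤ |c * ((v - u) * q - (F v - F u))| + ε * (v - u) :=
        (abs_add_le _ _).trans (by gcongr; exact H u hu v hv huξ hξv huδ hvδ)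
    _ = |c| * |(v - u) * q - (F v - F u)| + ε * (v - u) := by rw [abs_mul]

theorem saksHenstockSum_le_add {φ G : ℝ → ℝ} {I : Box (Fin 1)} {P : TaggedPrepartition I}
    (hP : P.IsPartition) {C ε : ℝ}
    (h : ∀ J ∈ P, |(J.upper 0 - J.lower 0) * φ (P.tag J 0) - (G (J.upper 0) - G (J.lower 0))| ≤
      C * |(J.upper 0 - J.lower 0) * f (P.tag J 0) - (F (J.upper 0) - F (J.lower 0))| +
        ε * (J.upper 0 - J.lower 0)) :
    saksHenstockSum φ G P ≤ C * saksHenstockSum f F P + ε * (I.upper 0 - I.lower 0) := by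
  have hlength : ∑ J ∈ P.boxes, (J.upper 0 - J.lower 0) = I.upper 0 - I.lower 0 :=
    sum_increment id hP
  refine (Finset.sum_le_sum h).trans_eq ?_
  rw [Finset.sum_add_distrib, ← Finset.mul_sum, ← Finset.mul_sum, hlength, saksHenstockSum]

/-- Near its tag `ξ`, the pair `(φ, G)` differs from `c ξ` times the pair `(f, F)` by an honest
derivative, so its Saks–Henstock sums are controlled by those of `(f, F)`. -/
theorem IsHKPrimitive.hasHKIntegral_of_hasDerivWithinAt_sub {φ G c : ℝ → ℝ} {C : ℝ}
    (h : IsHKPrimitive f F a b) (hab : a < b) (hc : ∀ ξ ∈ Icc a b, |c ξ| ≤ C)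
    (hG : ∀ ξ ∈ Icc a b, HasDerivWithinAt (fun x => G x - c ξ * F x) (φ ξ - c ξ * f ξ)
      (Icc a b) ξ) :
    HasHKIntegral φ a b (G b - G a) := by
  refine hasHKIntegral_of_forall_exists_gauge hab (C + (b - a)) fun ε hε => ?_
  obtain ⟨r, hr⟩ := h.exists_gauge hab hε
  have hstraddle : ∀ ξ, ∃ δ > 0, ξ ∈ Icc a b → ∀ u ∈ Icc a b, ∀ v ∈ Icc a b, u ≤ ξ → ξ ≤ v →
      |u - ξ| ≤ δ → |v - ξ| ≤ δ →
      |(v - u) * φ ξ - (G v - G u)| ≤ |c ξ| * |(v - u) * f ξ - (F v - F u)| + ε * (v - u) := by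
    intro ξ
    by_cases hξ : ξ ∈ Icc a b
    · obtain ⟨δ, hδ, H⟩ := exists_forall_abs_sub_le_of_hasDerivWithinAt_sub (hG ξ hξ) hε
      exact ⟨δ, hδ, fun _ => H⟩
    · exact ⟨1, one_pos, fun h => absurd h hξ⟩
  choose δ hδ hstraddle using hstraddle
  refine ⟨fun x => min (r x) ⟨δ (x 0), hδ _⟩, fun P hH hS hP => ?_⟩
  have hSr : P.IsSubordinate r := hS.mono' fun _ _ => min_le_left _ _
  have hSδ : P.IsSubordinate fun x => ⟨δ (x 0), hδ _⟩ := hS.mono' fun _ _ => min_le_right _ _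
  have hsum : saksHenstockSum φ G P ≤ C * saksHenstockSum f F P + ε * (b - a) := by
    refine saksHenstockSum_le_add hP fun J hJ => ?_
    have hmem : ∀ x ∈ Box.Icc J, x 0 ∈ Icc a b := fun x hx =>
      have hxI := Box.le_iff_Icc.1 (P.le_of_mem hJ) hx
      ⟨hxI.1 0, hxI.2 0⟩
    have htag := hH J hJ
    obtain ⟨hlow, hupp⟩ := abs_sub_tag_le_of_isSubordinate hSδ hJ
    refine (hstraddle _ (hmem _ htag) _ (hmem _ J.lower_mem_Icc) _ (hmem _ J.upper_mem_Icc)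
      (htag.1 0) (htag.2 0) hlow hupp).trans ?_
    gcongr
    exact hc _ (hmem _ htag)
  have hC : 0 ≤ C := (abs_nonneg _).trans (hc a (left_mem_Icc.2 hab.le))
  calc saksHenstockSum φ G P ≤ C * saksHenstockSum f F P + ε * (b - a) := hsum
    _ ≤ C * ε + ε * (b - a) := by gcongr; exact hr P hH hSr
    _ = (C + (b - a)) * ε := by ring

end SaksHenstock

section Calculus

variable {f F g g' : ℝ → ℝ} {a b : ℝ}

theorem hasHKIntegral_of_hasDerivWithinAt (hab : a < b)
    (h : ∀ x ∈ Icc a b, HasDerivWithinAt g (g' x) (Icc a b) x) :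
    HasHKIntegral g' a b (g b - g a) :=
  (isHKPrimitive_zero a b).hasHKIntegral_of_hasDerivWithinAt_sub (c := 0) (C := 0) hab
    (by simp) (by simpa using h)

theorem hasDerivWithinAt_integral_of_continuousOn (hg : ContinuousOn g (Icc a b)) {x : ℝ}
    (hx : x ∈ Icc a b) :
    HasDerivWithinAt (fun u => ∫ t in a..u, g t) (g x) (Icc a b) x := by
  have : Fact (x ∈ Icc a b) := ⟨hx⟩
  exact intervalIntegral.integral_hasDerivWithinAt_right
    ((hg.mono (Icc_subset_Icc_right hx.2)).intervalIntegrable_of_Icc hx.1)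
    (hg.stronglyMeasurableAtFilter_nhdsWithin measurableSet_Icc x) (hg x hx)

theorem hasHKIntegral_of_continuousOn (hab : a < b) (hg : ContinuousOn g (Icc a b)) :
    HasHKIntegral g a b (∫ x in a..b, g x) := by
  simpa using hasHKIntegral_of_hasDerivWithinAt hab
    fun x hx => hasDerivWithinAt_integral_of_continuousOn hg hx

theorem hasDerivWithinAt_mul_sub_of_continuousWithinAt {s : Set ℝ} {ξ k : ℝ}
    (hF : ContinuousWithinAt F s ξ) (hg : HasDerivWithinAt g k s ξ) :
    HasDerivWithinAt (fun x => F x * (g x - g ξ)) (F ξ * k) s ξ := by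
  rw [hasDerivWithinAt_iff_tendsto_slope] at hg ⊢
  refine ((hF.mono sdiff_subset).tendsto.mul hg).congr fun x => ?_
  simp only [slope_def_field, sub_self, mul_zero, sub_zero, mul_div_assoc]

/-- Integration by parts. With `H` the indefinite integral of `F * g'`, the function
`F * g - H - g ξ * F` has derivative zero at `ξ`, because `F` is continuous there. -/
theorem IsHKPrimitive.hasHKIntegral_mul (h : IsHKPrimitive f F a b) (hab : a < b)
    (hg : ∀ x ∈ Icc a b, HasDerivWithinAt g (g' x) (Icc a b) x) (hg' : ContinuousOn g' (Icc a b)) :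
    HasHKIntegral (fun x => f x * g x) a b
      (F b * g b - F a * g a - ∫ x in a..b, F x * g' x) := by
  have hF := h.continuousOn hab
  have hgc : ContinuousOn g (Icc a b) := fun x hx => (hg x hx).continuousWithinAt
  obtain ⟨C, hC⟩ := isCompact_Icc.exists_bound_of_continuousOn hgc
  have hparts := h.hasHKIntegral_of_hasDerivWithinAt_sub (φ := fun x => f x * g x)
    (G := fun x => F x * g x - ∫ t in a..x, F t * g' t) (c := g) hab hC fun ξ hξ => ?_
  · convert hparts using 1
    simp
    ring
  have hderiv := (hasDerivWithinAt_mul_sub_of_continuousWithinAt (hF ξ hξ) (hg ξ hξ)).sub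
    (hasDerivWithinAt_integral_of_continuousOn (hF.mul hg') hξ)
  refine (hderiv.congr_deriv (by rw [Pi.mul_apply]; ring)).congr_of_mem (fun x _ => ?_) hξ
  simp only [Pi.sub_apply, Pi.mul_apply]
  ring

end Calculus

section Translation

variable {ι : Type*}

/-- The translate of a box by a vector. -/
def translateBox (t : ι → ℝ) (J : Box ι) : Box ι where
  lower := J.lower + t
  upper := J.upper + t
  lower_lt_upper i := add_lt_add_left (J.lower_lt_upper i) (t i)

theorem mem_translateBox {t x : ι → ℝ} {J : Box ι} : x ∈ translateBox t J ↔ x - t ∈ J := by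
  simp only [Box.mem_def, translateBox, mem_Ioc, Pi.add_apply, Pi.sub_apply, lt_sub_iff_add_lt,
    sub_le_iff_le_add]

theorem mem_Icc_translateBox {t x : ι → ℝ} {J : Box ι} :
    x ∈ Box.Icc (translateBox t J) ↔ x - t ∈ Box.Icc J := by
  simp only [Box.Icc_def, translateBox, mem_Icc, le_sub_iff_add_le, sub_le_iff_le_add]

theorem translateBox_neg_translateBox (t : ι → ℝ) (J : Box ι) :
    translateBox (-t) (translateBox t J) = J := by
  ext x
  simp [mem_translateBox]

theorem translateBox_injective (t : ι → ℝ) : Function.Injective (translateBox t) :=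
  Function.LeftInverse.injective (translateBox_neg_translateBox t)

/-- The translate of a tagged prepartition by a vector. -/
def translateTagged (t : ι → ℝ) {I : Box ι} (P : TaggedPrepartition I) :
    TaggedPrepartition (translateBox t I) where
  boxes := P.boxes.map ⟨translateBox t, translateBox_injective t⟩
  le_of_mem' J hJ := by
    obtain ⟨J₀, hJ₀, rfl⟩ := Finset.mem_map.1 hJ
    exact fun x hx => mem_translateBox.2 (P.le_of_mem hJ₀ (mem_translateBox.1 hx))
  pairwiseDisjoint := by
    intro J hJ J' hJ' hne
    obtain ⟨J₀, hJ₀, rfl⟩ := Finset.mem_map.1 hJ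
    obtain ⟨J₁, hJ₁, rfl⟩ := Finset.mem_map.1 hJ'
    have hdisj := Set.disjoint_left.1 (P.pairwiseDisjoint hJ₀ hJ₁ (ne_of_apply_ne _ hne))
    exact Set.disjoint_left.2 fun x hx hx' =>
      hdisj (mem_translateBox.1 hx) (mem_translateBox.1 hx')
  tag J := P.tag (translateBox (-t) J) + t
  tag_mem_Icc J := mem_Icc_translateBox.2 (by simpa using P.tag_mem_Icc _)

variable {t : ι → ℝ} {I : Box ι} {P : TaggedPrepartition I}

theorem mem_translateTagged {J : Box ι} :
    J ∈ translateTagged t P ↔ ∃ J' ∈ P, translateBox t J' = J :=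
  Finset.mem_map

theorem tag_translateTagged (t : ι → ℝ) (P : TaggedPrepartition I) (J : Box ι) :
    (translateTagged t P).tag (translateBox t J) = P.tag J + t := by
  simp [translateTagged, translateBox_neg_translateBox]

theorem isHenstock_translateTagged (hP : P.IsHenstock) : (translateTagged t P).IsHenstock := by
  intro J hJ
  obtain ⟨J₀, hJ₀, rfl⟩ := mem_translateTagged.1 hJ
  rw [tag_translateTagged, mem_Icc_translateBox, add_sub_cancel_right]
  exact hP J₀ hJ₀

theorem isSubordinate_translateTagged [Fintype ι] {r : (ι → ℝ) → Ioi (0 : ℝ)}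
    (hP : P.IsSubordinate fun x => r (x + t)) : (translateTagged t P).IsSubordinate r := by
  intro J hJ x hx
  obtain ⟨J₀, hJ₀, rfl⟩ := mem_translateTagged.1 hJ
  rw [tag_translateTagged, Metric.mem_closedBall, ← sub_add_cancel x t, dist_add_right]
  exact hP J₀ hJ₀ (mem_Icc_translateBox.1 hx)

theorem saksHenstockSum_translateTagged (f F : ℝ → ℝ) (T : ℝ) {I : Box (Fin 1)}
    (P : TaggedPrepartition I) :
    saksHenstockSum f F (translateTagged (fun _ => T) P) =
      saksHenstockSum (fun x => f (x + T)) (fun x => F (x + T)) P := by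
  rw [saksHenstockSum, translateTagged, Finset.sum_map]
  refine Finset.sum_congr rfl fun J _ => ?_
  simp [translateBox]

theorem IsHKPrimitive.hasHKIntegral_comp_add_right {f F : ℝ → ℝ} {a b T : ℝ} (hab : a < b)
    (h : IsHKPrimitive f F (a + T) (b + T)) :
    HasHKIntegral (fun x => f (x + T)) a b (F (b + T) - F (a + T)) := by
  refine hasHKIntegral_of_forall_exists_gauge (G := fun x => F (x + T)) hab 1 fun ε hε => ?_
  obtain ⟨r, hr⟩ := h.exists_gauge (add_lt_add_left hab T) hε
  refine ⟨fun x => r (x + fun _ => T), fun P hH hS _ => ?_⟩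
  rw [one_mul, ← saksHenstockSum_translateTagged]
  exact hr (translateTagged (fun _ => T) P) (isHenstock_translateTagged hH)
    (isSubordinate_translateTagged hS)

theorem HasHKIntegral.comp_add_right {f : ℝ → ℝ} {a b y T : ℝ}
    (h : HasHKIntegral f (a + T) (b + T) y) : HasHKIntegral (fun x => f (x + T)) a b y := by
  simpa [h.hkIntegral_eq] using
    (HKIntegrable.isHKPrimitive ⟨y, h⟩).hasHKIntegral_comp_add_right (lt_of_add_lt_add_right h.lt)

theorem HasHKIntegral.of_add_zsmul_of_periodic {f : ℝ → ℝ} {a b y T : ℝ}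
    (hf : Function.Periodic f T) (n : ℤ) (h : HasHKIntegral f (a + n • T) (b + n • T) y) :
    HasHKIntegral f a b y := by
  simpa only [hf.zsmul n _] using h.comp_add_right

end Translation

section Periodic

variable {f F : ℝ → ℝ} {c T : ℝ}

theorem IsHKPrimitive.of_periodic (hT : 0 < T) (hf : Function.Periodic f T)
    (hF : Function.Periodic F T) (hint : ∀ u v, u < v → v - u ≤ T → HKIntegrable f u v)
    (h : IsHKPrimitive f F c (c + T)) (a : ℝ) : IsHKPrimitive f F a (a + T) := by
  have hnext : ∀ v, c + T < v → v ≤ c + T + T →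
      HasHKIntegral f (c + T) v (F v - F (c + T)) := fun v hv hvT => by
    have hshift := h c (v - T) le_rfl (by linarith) (by linarith)
    rw [hF.sub_eq, ← hF c] at hshift
    exact .of_add_zsmul_of_periodic hf (-1) (by simpa [← sub_eq_add_neg] using hshift)
  have hbase : ∀ u ∈ Ico c (c + T), ∀ v, u < v → v ≤ u + T → HasHKIntegral f u v (F v - F u) := by
    intro u hu v huv hvu
    rcases le_or_gt v (c + T) with hv | hv
    · exact h u v hu.1 huv hv
    · convert (hint u v huv (by linarith)).hasHKIntegral_add_adjacent (h u (c + T) hu.1 hu.2 le_rfl)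
        (hnext v hv (by linarith [hu.2])) using 1
      ring
  intro u v hau huv hva
  obtain ⟨n, hn, -⟩ := existsUnique_add_zsmul_mem_Ico hT u c
  refine .of_add_zsmul_of_periodic hf n ?_
  rw [← hF.zsmul n u, ← hF.zsmul n v]
  exact hbase _ hn _ (by gcongr) (by linarith)

theorem continuous_of_forall_isHKPrimitive (hT : 0 < T)
    (h : ∀ a, IsHKPrimitive f F a (a + T)) : Continuous F :=
  continuous_iff_continuousAt.2 fun x =>
    ((h (x - T / 2)).continuousOn (by linarith)).continuousAt
      (Icc_mem_nhds (by linarith) (by linarith))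

theorem exists_periodic_isHKPrimitive (hT : 0 < T) (hf : Function.Periodic f T)
    (hint : ∀ u v, u < v → v - u ≤ T → HKIntegrable f u v) (hmean : hkIntegral f 0 T = 0) :
    ∃ G, Function.Periodic G T ∧ ∀ a, IsHKPrimitive f G a (a + T) := by
  let G : ℝ → ℝ := fun x => hkIntegral f 0 (toIcoMod hT 0 x)
  have hG : Function.Periodic G T := fun x => by simp only [G, toIcoMod_add_right]
  have hIcc : ∀ x ∈ Icc 0 (0 + T), G x = hkIntegral f 0 x := by
    rintro x ⟨hx0, hxT⟩
    rcases hxT.eq_or_lt with rfl | hxT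
    · rw [hG 0]
      simp [G, hmean]
    · simp only [G, (toIcoMod_eq_self hT).2 ⟨hx0, hxT⟩]
  refine ⟨G, hG, IsHKPrimitive.of_periodic (c := 0) hT hf hG hint fun u v hu huv hv => ?_⟩
  rw [hIcc u ⟨hu, huv.le.trans hv⟩, hIcc v ⟨hu.trans huv.le, hv⟩]
  exact (hint 0 (0 + T) (by linarith) (by linarith)).isHKPrimitive u v hu huv hv

end Periodic

section AlexiewiczNorm

variable {f : ℝ → ℝ} {a b y : ℝ}

theorem hkIntegrable_of_alexiewiczNorm_lt_top (hf : alexiewiczNorm f < ⊤) (hab : a < b)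
    (hba : b - a ≤ 2 * π) : HKIntegrable f a b := by
  by_contra hint
  refine hf.not_ge (le_trans ?_ (le_iSup₂_of_le a b (le_iSup₂_of_le hab hba le_rfl)))
  rw [if_neg hint]

theorem HasHKIntegral.ofReal_abs_le_alexiewiczNorm (h : HasHKIntegral f a b y)
    (hba : b - a ≤ 2 * π) : ENNReal.ofReal |y| ≤ alexiewiczNorm f := by
  refine le_trans ?_ (le_iSup₂_of_le a b (le_iSup₂_of_le h.lt hba le_rfl))
  rw [if_pos ⟨y, h⟩, h.hkIntegral_eq]

theorem HasHKIntegral.abs_le_toReal_alexiewiczNorm (hf : alexiewiczNorm f < ⊤)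
    (h : HasHKIntegral f a b y) (hba : b - a ≤ 2 * π) : |y| ≤ (alexiewiczNorm f).toReal :=
  (ENNReal.ofReal_le_iff_le_toReal hf.ne).1 (h.ofReal_abs_le_alexiewiczNorm hba)

theorem alexiewiczNorm_le {C : ℝ}
    (h : ∀ a b, a < b → b - a ≤ 2 * π → ∃ y, HasHKIntegral f a b y ∧ |y| ≤ C) :
    alexiewiczNorm f ≤ ENNReal.ofReal C := by
  refine iSup₂_le fun a b => iSup₂_le fun hab hba => ?_
  obtain ⟨y, hy, hyC⟩ := h a b hab hba
  rw [if_pos ⟨y, hy⟩, hy.hkIntegral_eq]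
  exact ENNReal.ofReal_le_ofReal hyC

theorem abs_le_alexiewiczNorm_mul {g g' : ℝ → ℝ} (hf : alexiewiczNorm f < ⊤) (hba : b - a ≤ 2 * π)
    (hg : ∀ x ∈ Icc a b, HasDerivWithinAt g (g' x) (Icc a b) x) (hg' : ContinuousOn g' (Icc a b))
    (h : HasHKIntegral (fun x => f x * g x) a b y) :
    |y| ≤ (alexiewiczNorm f).toReal * (|g b| + ∫ x in a..b, |g' x|) := by
  have hab := h.lt
  let F : ℝ → ℝ := fun x => hkIntegral f a x
  have hprim : IsHKPrimitive f F a b :=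
    (hkIntegrable_of_alexiewiczNorm_lt_top hf hab hba).isHKPrimitive
  have hFa : F a = 0 := hkIntegral_self f a
  have hF : ∀ x ∈ Ioc a b, |F x| ≤ (alexiewiczNorm f).toReal := fun x hx => by
    simpa [hFa] using (hprim a x le_rfl hx.1 hx.2).abs_le_toReal_alexiewiczNorm hf
      (by linarith [hx.2])
  rw [h.unique (hprim.hasHKIntegral_mul hab hg hg'), hFa, zero_mul, sub_zero, mul_add]
  refine (abs_sub _ _).trans (add_le_add ?_ ?_)
  · rw [abs_mul]
    gcongr
    exact hF b ⟨hab, le_rfl⟩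
  · rw [← intervalIntegral.integral_const_mul]
    refine intervalIntegral.norm_integral_le_of_norm_le (f := fun x => F x * g' x) hab.le
      (.of_forall fun x hx => ?_)
      ((continuousOn_const.mul hg'.abs).intervalIntegrable_of_Icc hab.le)
    rw [norm_mul]
    exact mul_le_mul_of_nonneg_right (hF x hx) (norm_nonneg _)

theorem exists_periodic_primitive (hf : f ∈ HK) :
    ∃ (m : ℝ) (G : ℝ → ℝ), Function.Periodic G (2 * π) ∧
      ∀ a, IsHKPrimitive (fun x => f x - m) G a (a + 2 * π) := by
  obtain ⟨hper, hfin⟩ := hf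
  let m : ℝ := hkIntegral f 0 (2 * π) / (2 * π)
  have hconst : ∀ u v : ℝ, u < v → HasHKIntegral (fun _ => m) u v ((v - u) * m) := fun u v huv => by
    simpa using hasHKIntegral_of_continuousOn huv (continuousOn_const (c := m))
  have hint : ∀ u v, u < v → v - u ≤ 2 * π →
      HasHKIntegral (fun x => f x - m) u v (hkIntegral f u v - (v - u) * m) := fun u v huv hvu =>
    (hkIntegrable_of_alexiewiczNorm_lt_top hfin huv hvu).hasHKIntegral.sub (hconst u v huv)
  refine ⟨m, exists_periodic_isHKPrimitive Real.two_pi_pos (fun x => by simp only [hper x])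
    (fun u v huv hvu => ⟨_, hint u v huv hvu⟩) ?_⟩
  rw [(hint 0 (2 * π) Real.two_pi_pos (by simp)).hkIntegral_eq]
  simp only [m]
  field_simp
  ring

end AlexiewiczNorm

section BoundaryKernel

variable {z : ℂ} {r θ : ℝ}

theorem polar_eq_circleMap : polar = circleMap 0 := by
  ext r θ
  simp [polar, circleMap]

theorem polar_norm_arg (z : ℂ) : polar ‖z‖ z.arg = z :=
  Complex.norm_mul_exp_arg_mul_I z

theorem polar_mem_ball (h0 : 0 ≤ r) (h1 : r < 1) : polar r θ ∈ Metric.ball (0 : ℂ) 1 := by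
  simpa [polar_eq_circleMap, abs_of_nonneg h0] using h1

theorem circleMap_sub_ne_zero (hz : z ∈ Metric.ball (0 : ℂ) 1) (φ : ℝ) :
    circleMap 0 1 φ - z ≠ 0 :=
  sub_ne_zero.2 (circleMap_ne_mem_ball hz φ)

/-- The Poisson kernel of the unit disc with pole `z`, as a function of the boundary angle and
normalized to have integral `1` over a period. -/
noncomputable def boundaryKernel (z : ℂ) (φ : ℝ) : ℝ :=
  (2 * π)⁻¹ * _root_.poissonKernel 0 z (circleMap 0 1 φ)

/-- The derivative of `boundaryKernel z` in the boundary angle. -/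
noncomputable def boundaryKernelDeriv (z : ℂ) (φ : ℝ) : ℝ :=
  (2 * π)⁻¹ * (-(Complex.I * z * (2 * circleMap 0 1 φ / (circleMap 0 1 φ - z) ^ 2))).re

theorem boundaryKernel_polar (r θ φ : ℝ) :
    boundaryKernel (polar r θ) φ = poissonKernel r (φ - θ) := by
  have hdist : ‖circleMap 0 1 φ - polar r θ‖ ^ 2 = 1 - 2 * r * Real.cos (φ - θ) + r ^ 2 := by
    rw [← Complex.normSq_eq_norm_sq, Complex.normSq_apply]
    simp only [circleMap, polar, Complex.exp_ofReal_mul_I_re, Complex.exp_ofReal_mul_I_im,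
      Complex.sub_re, Complex.sub_im, Complex.re_ofReal_mul, Complex.im_ofReal_mul, zero_add,
      Real.cos_sub]
    linear_combination Real.sin_sq_add_cos_sq φ + r ^ 2 * Real.sin_sq_add_cos_sq θ
  rw [boundaryKernel, poissonKernel_def, sub_zero, sub_zero, hdist, polar_eq_circleMap,
    norm_circleMap_zero, norm_circleMap_zero, sq_abs, sq_abs, one_pow, poissonKernel,
    ← div_eq_inv_mul, div_div, mul_comm (2 * π)]

theorem poissonIntegral_eq_hkIntegral (f : ℝ → ℝ) (z : ℂ) :
    poissonIntegral f z = hkIntegral (fun φ => f φ * boundaryKernel z φ) (-π) π := by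
  simp only [poissonIntegral, ← boundaryKernel_polar, polar_norm_arg]

theorem boundaryKernel_nonneg (hz : z ∈ Metric.ball (0 : ℂ) 1) (φ : ℝ) :
    0 ≤ boundaryKernel z φ := by
  rw [mem_ball_zero_iff] at hz
  have hnum : 0 ≤ 1 - ‖z‖ ^ 2 := by nlinarith [norm_nonneg z]
  rw [boundaryKernel, poissonKernel_def]
  simp only [sub_zero, norm_circleMap_zero, abs_one, one_pow]
  positivity

theorem hasDerivAt_boundaryKernel (hz : z ∈ Metric.ball (0 : ℂ) 1) (φ : ℝ) :
    HasDerivAt (boundaryKernel z) (boundaryKernelDeriv z φ) φ := by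
  have hne := circleMap_sub_ne_zero hz φ
  have hcircle := hasDerivAt_circleMap 0 1 φ
  have hquot := (hcircle.add_const z).div (hcircle.sub_const z) hne
  have hre := (Complex.reCLM.hasFDerivAt.comp_hasDerivAt φ hquot).const_mul (2 * π)⁻¹
  have hkernel : boundaryKernel z = fun y => (2 * π)⁻¹ * (Complex.reCLM ∘
      ((fun x => circleMap 0 1 x + z) / fun x => circleMap 0 1 x - z)) y := by
    ext x
    simp [boundaryKernel, poissonKernel_eq_re_herglotzRieszKernel, herglotzRieszKernel_def]
  rw [hkernel]
  refine hre.congr_deriv ?_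
  rw [boundaryKernelDeriv, Complex.reCLM_apply]
  congr 2
  field_simp
  ring

@[fun_prop]
theorem continuous_boundaryKernel (hz : z ∈ Metric.ball (0 : ℂ) 1) :
    Continuous (boundaryKernel z) :=
  continuous_iff_continuousAt.2 fun φ => (hasDerivAt_boundaryKernel hz φ).continuousAt

theorem continuous_two_mul_circleMap_div_sq (hz : z ∈ Metric.ball (0 : ℂ) 1) :
    Continuous fun φ => 2 * circleMap 0 1 φ / (circleMap 0 1 φ - z) ^ 2 :=
  Continuous.div (by fun_prop) (by fun_prop) fun φ => pow_ne_zero 2 (circleMap_sub_ne_zero hz φ)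

theorem continuous_boundaryKernelDeriv (hz : z ∈ Metric.ball (0 : ℂ) 1) :
    Continuous (boundaryKernelDeriv z) := by
  have := continuous_two_mul_circleMap_div_sq hz
  unfold boundaryKernelDeriv
  fun_prop

theorem boundaryKernel_neg_pi (z : ℂ) : boundaryKernel z (-π) = boundaryKernel z π := by
  simp [boundaryKernel, circleMap, Complex.exp_neg]

end BoundaryKernel

section PoissonFormula

variable {u : ℂ → ℝ} {z : ℂ} {r θ R : ℝ}

theorem circleAverage_eq_integral_neg_pi_pi {E : Type*} [NormedAddCommGroup E] [NormedSpace ℝ E]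
    (H : ℂ → E) (c : ℂ) (R : ℝ) :
    Real.circleAverage H c R = (2 * π)⁻¹ • ∫ φ in -π..π, H (circleMap c R φ) := by
  rw [Real.circleAverage_eq_integral_add (-π),
    intervalIntegral.integral_comp_add_right (fun φ => H (circleMap c R φ))]
  congr 2 <;> ring

theorem poissonKernel_mul_circleMap (hR : R ≠ 0) (z : ℂ) (φ : ℝ) :
    _root_.poissonKernel 0 (R * z) (circleMap 0 R φ) =
      _root_.poissonKernel 0 z (circleMap 0 1 φ) := by
  have hscale : circleMap 0 R φ = R * circleMap 0 1 φ := by simp [circleMap]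
  rw [poissonKernel_eq_re_herglotzRieszKernel, poissonKernel_eq_re_herglotzRieszKernel, hscale]
  simp only [Function.comp_apply, herglotzRieszKernel_def, sub_zero]
  rw [← mul_add, ← mul_sub, mul_div_mul_left _ _ (Complex.ofReal_ne_zero.2 hR)]

theorem integral_mul_boundaryKernel_of_harmonicOnNhd (hR : 0 < R)
    (hu : InnerProductSpace.HarmonicOnNhd u (Metric.closedBall 0 R))
    (hz : z ∈ Metric.ball (0 : ℂ) 1) :
    ∫ φ in -π..π, u (polar R φ) * boundaryKernel z φ = u (R * z) := by
  have hRz : R * z ∈ Metric.ball (0 : ℂ) R := by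
    rw [mem_ball_zero_iff] at hz ⊢
    simpa [abs_of_pos hR] using mul_lt_of_lt_one_right hR hz
  rw [← hu.circleAverage_poissonKernel_smul hRz, circleAverage_eq_integral_neg_pi_pi, smul_eq_mul,
    ← intervalIntegral.integral_const_mul]
  refine intervalIntegral.integral_congr fun φ _ => ?_
  simp only [Pi.smul_apply', smul_eq_mul, poissonKernel_mul_circleMap hR.ne', boundaryKernel,
    polar_eq_circleMap]
  ring

theorem integral_boundaryKernel (hz : z ∈ Metric.ball (0 : ℂ) 1) :
    ∫ φ in -π..π, boundaryKernel z φ = 1 := by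
  simpa using integral_mul_boundaryKernel_of_harmonicOnNhd (u := fun _ => 1) one_pos
    (InnerProductSpace.harmonicOnNhd_const 1) hz

theorem integral_one_sub_cos_mul_boundaryKernel (h0 : 0 ≤ r) (h1 : r < 1) :
    ∫ φ in -π..π, (1 - Real.cos (φ - θ)) * boundaryKernel (polar r θ) φ = 1 - r := by
  let v : ℂ → ℝ := fun w => (1 - w * polar 1 (-θ)).re
  have hv : InnerProductSpace.HarmonicOnNhd v (Metric.closedBall 0 1) := fun w _ =>
    AnalyticAt.harmonicAt_re (by fun_prop)
  have hpolar : ∀ s φ, v (polar s φ) = 1 - s * Real.cos (φ - θ) := fun s φ => by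
    have hmul : polar s φ * polar 1 (-θ) = polar s (φ - θ) := by
      simp only [polar, Complex.ofReal_one, one_mul, mul_assoc, ← Complex.exp_add, ← add_mul,
        ← Complex.ofReal_add, sub_eq_add_neg]
    simp only [v, hmul, Complex.sub_re, Complex.one_re]
    simp only [polar, Complex.re_ofReal_mul, Complex.exp_ofReal_mul_I_re]
  simpa [hpolar] using
    integral_mul_boundaryKernel_of_harmonicOnNhd one_pos hv (polar_mem_ball (θ := θ) h0 h1)

end PoissonFormula

section Herglotz

variable {G : ℝ → ℝ} {r θ : ℝ} {z : ℂ}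

theorem apply_arg_circleMap_of_periodic {α : Type*} {H : ℝ → α} (hH : Function.Periodic H (2 * π))
    (φ : ℝ) : H (circleMap 0 1 φ).arg = H φ := by
  have hangle : ((circleMap 0 1 φ).arg : Real.Angle) = φ := by
    simp [circleMap, Complex.arg_exp_mul_I, Real.Angle.coe_toIocMod]
  obtain ⟨k, hk⟩ := Real.Angle.angle_eq_iff_two_pi_dvd_sub.1 hangle
  rw [eq_add_of_sub_eq hk, add_comm, mul_comm]
  simpa using hH.zsmul k φ

theorem circleIntegrable_apply_arg {E : Type*} [NormedAddCommGroup E] {H : ℝ → E}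
    (hHc : Continuous H) (hH : Function.Periodic H (2 * π)) :
    CircleIntegrable (fun ζ => H ζ.arg) 0 1 := by
  simp only [CircleIntegrable, apply_arg_circleMap_of_periodic hH]
  exact hHc.intervalIntegrable _ _

/-- The Herglotz integral of a `2π`-periodic function: a holomorphic function on the unit disc
whose real part is the classical Poisson integral. -/
noncomputable def herglotzIntegral (G : ℝ → ℝ) (w : ℂ) : ℂ :=
  Real.circleAverage (fun ζ => herglotzRieszKernel 0 w ζ • ((G ζ.arg : ℝ) : ℂ)) 0 1

theorem hasDerivAt_herglotzIntegral (hGc : Continuous G) (hG : Function.Periodic G (2 * π))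
    (hz : z ∈ Metric.ball (0 : ℂ) 1) :
    HasDerivAt (herglotzIntegral G)
      (Real.circleAverage (fun ζ => (2 * ζ / (ζ - z) ^ 2) • ((G ζ.arg : ℝ) : ℂ)) 0 1) z :=
  hasDerivAt_circleAverage_herglotzRieszKernel_smul
    (circleIntegrable_apply_arg (Complex.continuous_ofReal.comp hGc) (hG.comp Complex.ofReal)) hz

theorem analyticAt_herglotzIntegral (hGc : Continuous G) (hG : Function.Periodic G (2 * π))
    (hz : z ∈ Metric.ball (0 : ℂ) 1) : AnalyticAt ℂ (herglotzIntegral G) z :=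
  analyticOnNhd_circleAverage_herglotzRieszKernel_smul
    (circleIntegrable_apply_arg (Complex.continuous_ofReal.comp hGc) (hG.comp Complex.ofReal)) z hz

theorem re_herglotzIntegral (hGc : Continuous G) (hG : Function.Periodic G (2 * π))
    (hz : z ∈ Metric.ball (0 : ℂ) 1) :
    (herglotzIntegral G z).re = ∫ φ in -π..π, G φ * boundaryKernel z φ := by
  rw [herglotzIntegral,
    re_circleAverage_herglotzRieszKernel_smul (circleIntegrable_apply_arg hGc hG) hz,
    ← poissonKernel_eq_re_herglotzRieszKernel, circleAverage_eq_integral_neg_pi_pi, smul_eq_mul,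
    ← intervalIntegral.integral_const_mul]
  refine intervalIntegral.integral_congr fun φ _ => ?_
  simp only [Pi.mul_apply, smul_eq_mul, apply_arg_circleMap_of_periodic hG, boundaryKernel]
  ring

theorem re_I_mul_deriv_herglotzIntegral (hGc : Continuous G) (hG : Function.Periodic G (2 * π))
    (hz : z ∈ Metric.ball (0 : ℂ) 1) :
    (Complex.I * z * deriv (herglotzIntegral G) z).re =
      -∫ φ in -π..π, G φ * boundaryKernelDeriv z φ := by
  have hcont : Continuous fun φ => Complex.I * z *
      ((2 * circleMap 0 1 φ / (circleMap 0 1 φ - z) ^ 2) • (G φ : ℂ)) := by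
    have := continuous_two_mul_circleMap_div_sq hz
    fun_prop
  have hre := Complex.reCLM.intervalIntegral_comp_comm
    (hcont.intervalIntegrable (μ := volume) (-π) π)
  rw [(hasDerivAt_herglotzIntegral hGc hG hz).deriv, circleAverage_eq_integral_neg_pi_pi,
    mul_smul_comm, Complex.smul_re]
  simp only [apply_arg_circleMap_of_periodic hG]
  rw [← intervalIntegral.integral_const_mul, ← Complex.reCLM_apply, ← hre, smul_eq_mul,
    ← intervalIntegral.integral_const_mul, ← intervalIntegral.integral_neg]
  refine intervalIntegral.integral_congr fun φ _ => ?_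
  simp only [boundaryKernelDeriv, Complex.reCLM_apply, smul_eq_mul, ← mul_assoc,
    Complex.re_mul_ofReal, Complex.neg_re]
  ring

theorem hasDerivAt_re_comp_polar {h : ℂ → ℂ} {h' : ℂ} (H : HasDerivAt h h' (polar r θ)) :
    HasDerivAt (fun θ => (h (polar r θ)).re) (Complex.I * polar r θ * h').re θ := by
  rw [polar_eq_circleMap] at H ⊢
  have hcomp := H.comp_of_eq θ (hasDerivAt_circleMap 0 r θ) rfl
  refine (Complex.reCLM.hasFDerivAt.comp_hasDerivAt θ hcomp).congr_deriv ?_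
  rw [Complex.reCLM_apply]
  congr 1
  ring

end Herglotz

section PoissonIntegral

variable {f G : ℝ → ℝ} {m : ℝ} {z : ℂ}

theorem HKIntegrable.hasHKIntegral_poissonIntegral (hf : HKIntegrable f (-π) π)
    (hz : z ∈ Metric.ball (0 : ℂ) 1) :
    HasHKIntegral (fun φ => f φ * boundaryKernel z φ) (-π) π (poissonIntegral f z) := by
  rw [poissonIntegral_eq_hkIntegral]
  exact HKIntegrable.hasHKIntegral ⟨_, hf.isHKPrimitive.hasHKIntegral_mul
    (neg_lt_self Real.pi_pos) (fun x _ => (hasDerivAt_boundaryKernel hz x).hasDerivWithinAt)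
    (continuous_boundaryKernelDeriv hz).continuousOn⟩

/-- Integrating by parts against the continuous primitive `G` moves the angular derivative onto the
Poisson kernel, and hence onto the Herglotz integral of `G`. -/
theorem poissonIntegral_eq_add_re_deriv_herglotzIntegral
    (h : IsHKPrimitive (fun x => f x - m) G (-π) π) (hGc : Continuous G)
    (hG : Function.Periodic G (2 * π)) (hz : z ∈ Metric.ball (0 : ℂ) 1) :
    poissonIntegral f z = m + (Complex.I * z * deriv (herglotzIntegral G) z).re := by
  have hπ : -π < π := neg_lt_self Real.pi_pos
  have hparts := h.hasHKIntegral_mul hπ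
    (fun x _ => (hasDerivAt_boundaryKernel hz x).hasDerivWithinAt)
    (continuous_boundaryKernelDeriv hz).continuousOn
  have hconst := hasHKIntegral_of_continuousOn hπ
    ((continuous_boundaryKernel hz).const_mul m).continuousOn
  have hGπ : G (-π) = G π := by
    rw [← hG (-π)]
    ring_nf
  rw [poissonIntegral_eq_hkIntegral, re_I_mul_deriv_herglotzIntegral hGc hG hz]
  convert (hconst.add hparts).hkIntegral_eq using 2
  · ext φ
    ring
  · rw [intervalIntegral.integral_const_mul, integral_boundaryKernel hz, mul_one]
  · rw [boundaryKernel_neg_pi, hGπ]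
    ring

theorem harmonicOnNhd_poissonIntegral
    (h : IsHKPrimitive (fun x => f x - m) G (-π) π) (hGc : Continuous G)
    (hG : Function.Periodic G (2 * π)) :
    InnerProductSpace.HarmonicOnNhd (poissonIntegral f) (Metric.ball 0 1) := by
  intro z hz
  have hanalytic : AnalyticAt ℂ (fun w => m + Complex.I * w * deriv (herglotzIntegral G) w) z :=
    analyticAt_const.add ((analyticAt_const.mul analyticAt_id).mul
      (analyticAt_herglotzIntegral hGc hG hz).deriv)
  refine (InnerProductSpace.harmonicAt_congr_nhds ?_).1 hanalytic.harmonicAt_re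
  filter_upwards [Metric.isOpen_ball.mem_nhds hz] with w hw
  rw [poissonIntegral_eq_add_re_deriv_herglotzIntegral h hGc hG hw, Complex.add_re,
    Complex.ofReal_re]

end PoissonIntegral

section BoundaryValues

variable {f G : ℝ → ℝ} {m r θ ε M : ℝ}

theorem uniformContinuous_of_periodic {E : Type*} [UniformSpace E] {H : ℝ → E} {T : ℝ}
    (hT : 0 < T) (hHc : Continuous H) (hH : Function.Periodic H T) : UniformContinuous H := by
  have : Fact (0 < T) := ⟨hT⟩
  have hlift : Continuous hH.lift := hHc.quotient_liftOn' _
  exact (CompactSpace.uniformContinuous_of_continuous hlift).comp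
    (uniformContinuous_addMonoidHom_of_continuous
      (f := QuotientAddGroup.mk' (AddSubgroup.zmultiples T)) (AddCircle.continuous_mk' T))

theorem exists_abs_sub_zsmul_two_pi_le_pi (x : ℝ) : ∃ n : ℤ, |x - n • (2 * π)| ≤ π := by
  obtain ⟨n, ⟨hlo, hhi⟩, -⟩ := existsUnique_sub_zsmul_mem_Ico Real.two_pi_pos x (-π)
  exact ⟨n, abs_le.2 ⟨hlo, by linarith⟩⟩

theorem exists_abs_sub_le_add_mul_one_sub_cos (hGc : Continuous G)
    (hG : Function.Periodic G (2 * π)) (hε : 0 < ε) :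
    ∃ M, ∀ x y, |G x - G y| ≤ ε + M * (1 - Real.cos (x - y)) := by
  obtain ⟨C, hC⟩ := (hG.isBounded_of_continuous Real.two_pi_pos.ne' hGc).exists_norm_le
  obtain ⟨δ, hδ, hGδ⟩ := Metric.uniformContinuous_iff.1
    (uniformContinuous_of_periodic Real.two_pi_pos hGc hG) ε hε
  have hGC : ∀ x, |G x| ≤ C := fun x => hC _ (mem_range_self x)
  have hC0 : 0 ≤ C := (abs_nonneg _).trans (hGC 0)
  suffices hle : ∀ x y, |x - y| ≤ π →
      |G x - G y| ≤ ε + C * (π ^ 2 / δ ^ 2) * (1 - Real.cos (x - y)) by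
    refine ⟨C * (π ^ 2 / δ ^ 2), fun x y => ?_⟩
    obtain ⟨n, hn⟩ := exists_abs_sub_zsmul_two_pi_le_pi (x - y)
    rw [sub_right_comm] at hn
    simpa only [sub_right_comm x _ y, hG.sub_zsmul_eq, Real.cos_periodic.sub_zsmul_eq]
      using hle _ _ hn
  intro x y hxy
  have hcos := sub_nonneg.2 (Real.cos_le_one (x - y))
  rcases lt_or_ge |x - y| δ with hnear | hfar
  · have hnonneg : 0 ≤ C * (π ^ 2 / δ ^ 2) * (1 - Real.cos (x - y)) := by positivity
    exact (hGδ hnear).le.trans (le_add_of_nonneg_right hnonneg)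
  · have hcosδ : 2 / π ^ 2 * δ ^ 2 ≤ 1 - Real.cos (x - y) :=
      calc 2 / π ^ 2 * δ ^ 2 ≤ 2 / π ^ 2 * (x - y) ^ 2 := by
            rw [← sq_abs (x - y)]
            gcongr
        _ ≤ 1 - Real.cos (x - y) := by linarith [Real.cos_le_one_sub_mul_cos_sq hxy]
    calc |G x - G y| ≤ C + C := (abs_sub _ _).trans (add_le_add (hGC x) (hGC y))
      _ = C * (π ^ 2 / δ ^ 2) * (2 / π ^ 2 * δ ^ 2) := by field_simp; ring
      _ ≤ C * (π ^ 2 / δ ^ 2) * (1 - Real.cos (x - y)) := by gcongr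
      _ ≤ ε + C * (π ^ 2 / δ ^ 2) * (1 - Real.cos (x - y)) := by linarith

theorem abs_re_herglotzIntegral_polar_sub_le (hGc : Continuous G) (hG : Function.Periodic G (2 * π))
    (h0 : 0 ≤ r) (h1 : r < 1) (h : ∀ φ, |G φ - G θ| ≤ ε + M * (1 - Real.cos (φ - θ))) :
    |(herglotzIntegral G (polar r θ)).re - G θ| ≤ ε + M * (1 - r) := by
  have hz := polar_mem_ball (θ := θ) h0 h1
  have hdiff : (herglotzIntegral G (polar r θ)).re - G θ =
      ∫ φ in -π..π, (G φ - G θ) * boundaryKernel (polar r θ) φ := by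
    simp only [sub_mul]
    rw [intervalIntegral.integral_sub (Continuous.intervalIntegrable (by fun_prop) _ _)
      (Continuous.intervalIntegrable (by fun_prop) _ _), intervalIntegral.integral_const_mul,
      integral_boundaryKernel hz, mul_one, re_herglotzIntegral hGc hG hz]
  have hbound : ∫ φ in -π..π, (ε * boundaryKernel (polar r θ) φ +
      M * ((1 - Real.cos (φ - θ)) * boundaryKernel (polar r θ) φ)) = ε + M * (1 - r) := by
    rw [intervalIntegral.integral_add (Continuous.intervalIntegrable (by fun_prop) _ _)
      (Continuous.intervalIntegrable (by fun_prop) _ _), intervalIntegral.integral_const_mul,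
      intervalIntegral.integral_const_mul, integral_boundaryKernel hz,
      integral_one_sub_cos_mul_boundaryKernel h0 h1, mul_one]
  rw [hdiff, ← hbound]
  refine intervalIntegral.norm_integral_le_of_norm_le
    (f := fun φ => (G φ - G θ) * boundaryKernel (polar r θ) φ) (neg_lt_self Real.pi_pos).le
    (.of_forall fun φ _ => ?_) (Continuous.intervalIntegrable (by fun_prop) _ _)
  rw [norm_mul, Real.norm_of_nonneg (boundaryKernel_nonneg hz φ), ← mul_assoc, ← add_mul]
  exact mul_le_mul_of_nonneg_right (h φ) (boundaryKernel_nonneg hz φ)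

theorem eventually_abs_re_herglotzIntegral_polar_sub_le (hGc : Continuous G)
    (hG : Function.Periodic G (2 * π)) (hε : 0 < ε) :
    ∀ᶠ r in 𝓝[<] (1 : ℝ), ∀ θ, |(herglotzIntegral G (polar r θ)).re - G θ| ≤ ε := by
  obtain ⟨M, hM⟩ := exists_abs_sub_le_add_mul_one_sub_cos hGc hG (half_pos hε)
  have hlim : Tendsto (fun r : ℝ => ε / 2 + M * (1 - r)) (𝓝[<] 1) (𝓝 (ε / 2)) :=
    (Continuous.tendsto' (by fun_prop) _ _ (by ring)).mono_left nhdsWithin_le_nhds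
  filter_upwards [hlim.eventually_le_const (half_lt_self hε),
    Ioo_mem_nhdsLT (zero_lt_one' ℝ)] with r hr hr01 θ
  exact (abs_re_herglotzIntegral_polar_sub_le hGc hG hr01.1.le hr01.2 fun φ => hM φ θ).trans hr

theorem alexiewiczNorm_poissonIntegral_sub_le
    (h : ∀ a, IsHKPrimitive (fun x => f x - m) G a (a + 2 * π)) (hG : Function.Periodic G (2 * π))
    (h0 : 0 ≤ r) (h1 : r < 1) (hε : ∀ θ, |(herglotzIntegral G (polar r θ)).re - G θ| ≤ ε) :
    alexiewiczNorm (fun θ => poissonIntegral f (polar r θ) - f θ) ≤ ENNReal.ofReal (ε + ε) := by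
  have hGc := continuous_of_forall_isHKPrimitive Real.two_pi_pos h
  have hprim : IsHKPrimitive (fun x => f x - m) G (-π) π := by
    simpa [two_mul] using h (-π)
  refine alexiewiczNorm_le fun a b hab hba => ?_
  have hPoisson := hasHKIntegral_of_hasDerivWithinAt hab fun θ _ =>
    (hasDerivAt_re_comp_polar (analyticAt_herglotzIntegral hGc hG
      (polar_mem_ball (θ := θ) h0 h1)).differentiableAt.hasDerivAt).hasDerivWithinAt
  have hdiff := hPoisson.sub (h a a b le_rfl hab (by linarith))
  refine ⟨_, ?_, (abs_sub _ _).trans (add_le_add (hε b) (hε a))⟩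
  convert hdiff using 1
  · ext θ
    rw [poissonIntegral_eq_add_re_deriv_herglotzIntegral hprim hGc hG (polar_mem_ball h0 h1)]
    ring
  · ring

theorem tendsto_alexiewiczNorm_poissonIntegral_sub
    (h : ∀ a, IsHKPrimitive (fun x => f x - m) G a (a + 2 * π)) (hG : Function.Periodic G (2 * π)) :
    Tendsto (fun r : ℝ => alexiewiczNorm (fun θ => poissonIntegral f (polar r θ) - f θ))
      (𝓝[<] 1) (𝓝 0) := by
  refine ENNReal.tendsto_nhds_zero.2 fun ε hε => ?_
  obtain ⟨c, hc0, hcε⟩ := ENNReal.lt_iff_exists_nnreal_btwn.1 hε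
  have hc : (0 : ℝ) < c := by exact_mod_cast hc0
  filter_upwards [eventually_abs_re_herglotzIntegral_polar_sub_le
    (continuous_of_forall_isHKPrimitive Real.two_pi_pos h) hG (half_pos hc),
    Ioo_mem_nhdsLT (zero_lt_one' ℝ)] with r hr hr01
  refine (alexiewiczNorm_poissonIntegral_sub_le h hG hr01.1.le hr01.2 hr).trans ?_
  rw [add_halves, ENNReal.ofReal_coe_nnreal]
  exact hcε.le

theorem isDirichletSolution_poissonIntegral (hf : f ∈ HK) :
    IsDirichletSolution f (poissonIntegral f) := by
  obtain ⟨m, G, hG, h⟩ := exists_periodic_primitive hf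
  have hprim : IsHKPrimitive (fun x => f x - m) G (-π) π := by
    simpa [two_mul] using h (-π)
  have hharm := harmonicOnNhd_poissonIntegral hprim
    (continuous_of_forall_isHKPrimitive Real.two_pi_pos h) hG
  exact ⟨hharm.contDiffOn, fun z hz => (hharm z hz).2.self_of_nhds,
    tendsto_alexiewiczNorm_poissonIntegral_sub h hG⟩

end BoundaryValues

section Uniqueness

variable {f : ℝ → ℝ} {u : ℂ → ℝ} {z : ℂ} {R : ℝ}

theorem IsDirichletSolution.harmonicOnNhd (h : IsDirichletSolution f u) :
    InnerProductSpace.HarmonicOnNhd u (Metric.ball 0 1) := fun z hz =>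
  ⟨h.contDiffOn.contDiffAt (Metric.isOpen_ball.mem_nhds hz), by
    filter_upwards [Metric.isOpen_ball.mem_nhds hz] with w hw using h.laplacian_eq_zero w hw⟩

theorem abs_sub_poissonIntegral_le (hu : InnerProductSpace.HarmonicOnNhd u (Metric.closedBall 0 R))
    (hR : 0 < R) (hf : HKIntegrable f (-π) π)
    (hfin : alexiewiczNorm (fun θ => u (polar R θ) - f θ) < ⊤) (hz : z ∈ Metric.ball (0 : ℂ) 1) :
    |u (R * z) - poissonIntegral f z| ≤ (alexiewiczNorm fun θ => u (polar R θ) - f θ).toReal *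
      (|boundaryKernel z π| + ∫ φ in -π..π, |boundaryKernelDeriv z φ|) := by
  have hcont : Continuous fun φ => u (polar R φ) := by
    rw [polar_eq_circleMap]
    exact hu.continuousOn.comp_continuous (continuous_circleMap 0 R)
      fun φ => circleMap_mem_closedBall 0 hR.le φ
  have hcircle :
      HasHKIntegral (fun φ => u (polar R φ) * boundaryKernel z φ) (-π) π (u (R * z)) := by
    rw [← integral_mul_boundaryKernel_of_harmonicOnNhd hR hu hz]
    exact hasHKIntegral_of_continuousOn (neg_lt_self Real.pi_pos)
      (hcont.mul (continuous_boundaryKernel hz)).continuousOn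
  refine abs_le_alexiewiczNorm_mul hfin (by linarith)
    (fun x _ => (hasDerivAt_boundaryKernel hz x).hasDerivWithinAt)
    (continuous_boundaryKernelDeriv hz).continuousOn ?_
  simpa only [sub_mul] using hcircle.sub (hf.hasHKIntegral_poissonIntegral hz)

theorem IsDirichletSolution.eqOn_poissonIntegral (hu : IsDirichletSolution f u)
    (hf : HKIntegrable f (-π) π) : EqOn u (poissonIntegral f) (Metric.ball 0 1) := by
  intro z hz
  have hnorm := (ENNReal.tendsto_toReal ENNReal.zero_ne_top).comp hu.tendsto_boundary
  have hbound := hnorm.mul_const (|boundaryKernel z π| + ∫ φ in -π..π, |boundaryKernelDeriv z φ|)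
  rw [ENNReal.toReal_zero, zero_mul] at hbound
  have hPoisson : Tendsto (fun R : ℝ => u (R * z)) (𝓝[<] 1) (𝓝 (poissonIntegral f z)) := by
    refine tendsto_iff_norm_sub_tendsto_zero.2
      (squeeze_zero' (.of_forall fun R => norm_nonneg _) ?_ hbound)
    filter_upwards [hu.tendsto_boundary.eventually_lt_const ENNReal.zero_lt_top,
      Ioo_mem_nhdsLT (zero_lt_one' ℝ)] with R hfin hR
    exact abs_sub_poissonIntegral_le
      (hu.harmonicOnNhd.mono (Metric.closedBall_subset_ball hR.2)) hR.1 hf hfin hz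
  have hscale : Tendsto (fun R : ℝ => (R * z : ℂ)) (𝓝[<] 1) (𝓝 z) :=
    (Continuous.tendsto' (by fun_prop) _ _ (by simp)).mono_left nhdsWithin_le_nhds
  have hcont := hu.contDiffOn.continuousOn.continuousAt (Metric.isOpen_ball.mem_nhds hz)
  exact tendsto_nhds_unique (hcont.tendsto.comp hscale) hPoisson

end Uniqueness

end HKPoisson

theorem mainTheorem3 (f : ℝ → ℝ) (hf : f ∈ HKPoisson.HK) :
    (∀ r θ : ℝ, 0 ≤ r → r < 1 →
      HKPoisson.HasHKIntegral (fun φ => f φ * HKPoisson.poissonKernel r (φ - θ))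
        (-Real.pi) Real.pi (HKPoisson.poissonIntegral f (HKPoisson.polar r θ))) ∧
    HKPoisson.IsDirichletSolution f (HKPoisson.poissonIntegral f) ∧
    ∀ u : ℂ → ℝ, HKPoisson.IsDirichletSolution f u →
      Set.EqOn u (HKPoisson.poissonIntegral f) (Metric.ball 0 1) := by
  open HKPoisson in
  have hint : HKIntegrable f (-Real.pi) Real.pi :=
    hkIntegrable_of_alexiewiczNorm_lt_top hf.2 (neg_lt_self Real.pi_pos) (by linarith)
  refine ⟨fun r θ h0 h1 => ?_, isDirichletSolution_poissonIntegral hf,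
    fun u hu => hu.eqOn_poissonIntegral hint⟩
  simpa only [boundaryKernel_polar] using
    hint.hasHKIntegral_poissonIntegral (polar_mem_ball h0 h1)
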